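/- Let $C^nX$ denote the $n$-controlled $X$ gate, which flips a target qubit exactly when all $n$ control qubits are in state $|1\rangle$. There is a family of quantum circuits $(\mathcal C_n)_{n\ge 0}$, where $\mathcal C_n$ acts on $n$ control qubits, one target qubit and one borrowed (dirty) ancilla qubit and consists only of arbitrary single-qubit unitary gates and CNOT gates (between any two qubits), such that - for every $n$, $\mathcal C_n$ implements exactly $C^nX$ on the controls and the target tensored with the identity on the ancilla; in particular, the ancilla may start in any unknown state, possibly entangled with the other qubits, and is returned to that state; and - the depth of $\mathcal C_n$, i.e. its number of layers of gates acting on pairwise disjoint qubits, is $O\left((\log n)^{2.799}\right)$ as $n\to\infty$. -/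

import Mathlib

/-- An elementary gate on qubits labelled by `ι`: an arbitrary single-qubit unitary, or a CNOT on two
distinct qubits. -/
inductive Gate (ι : Type*) where
  | single (q : ι) (U : Matrix.unitaryGroup (Fin 2) ℂ) : Gate ι
  | cnot (c t : ι) (h : c ≠ t) : Gate ι

namespace Gate

variable {ι : Type*} [Fintype ι] [DecidableEq ι]

/-- The qubits on which a gate acts. -/
def support : Gate ι → Finset ι
  | single q _ => {q}
  | cnot c t _ => {c, t}

/-- The operator of a gate on the whole register, as a matrix in the computational basis
`ι → Fin 2` (row: output, column: input). A single-qubit gate is tensored with the identity on the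
other qubits. CNOT sends `|x⟩` to `|x'⟩`, where `x'` is `x` with `x t` replaced by `x t + x c`
(addition modulo two). -/
def toMatrix : Gate ι → Matrix (ι → Fin 2) (ι → Fin 2) ℂ
  | single q U => Matrix.of fun y x =>
      if ∀ j, j ≠ q → y j = x j then (U : Matrix (Fin 2) (Fin 2) ℂ) (y q) (x q) else 0
  | cnot c t _ => Matrix.of fun y x =>
      if y = Function.update x t (x t + x c) then 1 else 0

end Gate

/-- A layer (time step): gates that act on pairwise disjoint sets of qubits. -/
structure Layer (ι : Type*) [Fintype ι] [DecidableEq ι] where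
  gates : List (Gate ι)
  disjoint : gates.Pairwise fun g g' => Disjoint g.support g'.support

/-- The operator of a layer; its gates commute, so their order is immaterial. -/
def Layer.toMatrix {ι : Type*} [Fintype ι] [DecidableEq ι] (L : Layer ι) :
    Matrix (ι → Fin 2) (ι → Fin 2) ℂ :=
  (L.gates.map Gate.toMatrix).prod

/-- A quantum circuit of single-qubit and CNOT gates: a sequence of layers, in order of time. -/
def QCircuit (ι : Type*) [Fintype ι] [DecidableEq ι] : Type _ := List (Layer ι)

namespace QCircuit

variable {ι : Type*} [Fintype ι] [DecidableEq ι]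

/-- The operator of a circuit: the head of the list is applied first. -/
def toMatrix : QCircuit ι → Matrix (ι → Fin 2) (ι → Fin 2) ℂ
  | [] => 1
  | L :: C => toMatrix C * L.toMatrix

/-- The depth of a circuit: its number of layers. -/
def depth (C : QCircuit ι) : ℕ := List.length C

end QCircuit

/-- The multi-controlled `X` gate with control set `S` and target `t`, acting as the identity on all
other qubits: it flips `t` exactly when all qubits of `S` are `1`. -/
def mcx {ι : Type*} [Fintype ι] [DecidableEq ι] (S : Finset ι) (t : ι) :
    Matrix (ι → Fin 2) (ι → Fin 2) ℂ :=
  Matrix.of fun y x =>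
    if y = (if ∀ c ∈ S, x c = 1 then Function.update x t (x t + 1) else x) then 1 else 0

/-- The register of an `n`-controlled gate with one ancilla: `n` controls, one ancilla, one target. -/
abbrev Register (n : ℕ) : Type := Fin n ⊕ Fin 2

namespace Register

/-- The control qubits. -/
def controls (n : ℕ) : Finset (Register n) := Finset.univ.map Function.Embedding.inl

/-- The ancilla qubit. -/
def ancilla (n : ℕ) : Register n := Sum.inr 0

/-- The target qubit. -/
def target (n : ℕ) : Register n := Sum.inr 1

end Register

/-- The circuit implements the `n`-controlled `X` gate with one borrowed (dirty) ancilla: on the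
whole register, for every state of the ancilla, possibly entangled with the other qubits, it acts
exactly as the gate on controls and target and as the identity on the ancilla. -/
def ImplementsMCXBorrowed (n : ℕ) (C : QCircuit (Register n)) : Prop :=
  C.toMatrix = mcx (Register.controls n) (Register.target n)

/-! The construction in fact has depth O((log n)²), obtained by turning controls into workspace.
Suppose that m qubits are known to be one. Flipping them gives m clean zeros, enough for a balanced
Toffoli tree on m + 1 controls. If the root of the tree, the flag, is one, then every control read
and every partial conjunction written is one. The 2m tree qubits other than the root are then again
known ones, and the supply has doubled. If the flag is zero the supply is corrupted, but the overall
conjunction is zero anyway, so later garbage does no harm. After about log n stages of depth O(log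
n) the conjunction of all controls equals that of O(log n) flags (`exists_and_tree`,
`exists_flags`).

The first known one is a control c. The correction for c = 0 uses the commutator identity
`xorAt_commutator`: adding c to the borrowed qubit between two uses of a gate controlled by that
qubit leaves exactly a term multiplied by c. For c = 0 the two uses cancel, whatever the flags are.
The gate on the flags and the borrowed qubit is built in quadratic depth by recursion on the same
commutator, with idle qubits borrowed as ancillas (`Realizes.xorAt_allOne`). As there are only O(log
n) flags, this again costs O((log n)²). -/

open Function

set_option linter.unusedSectionVars false

variable {ι : Type*} [Fintype ι] [DecidableEq ι]

/-! ### Locality and commutation of gates -/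

/-- The operator acts only on the qubits in `A`: it is the tensor product of an operator on these
qubits with the identity on the others. -/
def ActsOn (A : Finset ι) (M : Matrix (ι → Fin 2) (ι → Fin 2) ℂ) : Prop :=
  (∀ y x i, i ∉ A → y i ≠ x i → M y x = 0) ∧
    ∀ y x y' x', (∀ i ∈ A, y i = y' i) → (∀ i ∈ A, x i = x' i) →
      (∀ i, i ∉ A → y i = x i) → (∀ i, i ∉ A → y' i = x' i) → M y x = M y' x'

/-- Only one intermediate state contributes to the matrix product: `N` fixes the qubits of `A`,
which keep their input values, and `M` fixes all others, which already have their output values. -/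
theorem ActsOn.mul_apply {A B : Finset ι} {M N : Matrix (ι → Fin 2) (ι → Fin 2) ℂ}
    (hM : ActsOn A M) (hN : ActsOn B N) (h : Disjoint A B) (y x : ι → Fin 2) :
    (M * N) y x = M y (A.piecewise x y) * N (A.piecewise x y) x := by
  rw [Matrix.mul_apply]
  refine Finset.sum_eq_single _ (fun z _ hz => ?_) (fun h => absurd (Finset.mem_univ _) h)
  obtain ⟨i, hi⟩ := Function.ne_iff.1 hz
  by_cases hA : i ∈ A
  · rw [Finset.piecewise_eq_of_mem _ _ _ hA] at hi
    rw [hN.1 z x i (Finset.disjoint_left.1 h hA) hi, mul_zero]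
  · rw [Finset.piecewise_eq_of_notMem _ _ _ hA] at hi
    rw [hM.1 y z i hA (Ne.symm hi), zero_mul]

theorem ActsOn.commute {A B : Finset ι} {M N : Matrix (ι → Fin 2) (ι → Fin 2) ℂ}
    (hM : ActsOn A M) (hN : ActsOn B N) (h : Disjoint A B) : Commute M N := by
  have hAB : ∀ i, i ∈ A → i ∉ B := fun i hi => Finset.disjoint_left.1 h hi
  ext y x
  rw [hM.mul_apply hN h, hN.mul_apply hM h.symm]
  by_cases hyx : ∀ i, i ∉ A → i ∉ B → y i = x i
  · rw [mul_comm]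
    congr 1
    · apply hN.2 <;> intro i hi <;> simp only [Finset.piecewise] <;> grind
    · apply hM.2 <;> intro i hi <;> simp only [Finset.piecewise] <;> grind
  · push Not at hyx
    obtain ⟨i, hA, hB, hi⟩ := hyx
    rw [hN.1 (A.piecewise x y) x i hB (by simpa [hA] using hi),
      hM.1 (B.piecewise x y) x i hA (by simpa [hB] using hi), mul_zero, mul_zero]

theorem Gate.actsOn (g : Gate ι) : ActsOn g.support g.toMatrix := by
  cases g with
  | single q U =>
    simp only [ActsOn, Gate.support, Gate.toMatrix, Matrix.of_apply, Finset.mem_singleton]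
    refine ⟨fun y x i hi hne => if_neg fun h => hne (h i hi), fun y x y' x' hy hx h h' => ?_⟩
    rw [if_pos h, if_pos h', hy q rfl, hx q rfl]
  | cnot c t hct =>
    simp only [ActsOn, Gate.support, Gate.toMatrix, Matrix.of_apply, Finset.mem_insert,
      Finset.mem_singleton, not_or]
    refine ⟨fun y x i hi hne => if_neg fun h => hne ?_, fun y x y' x' hy hx h h' => ?_⟩
    · rw [h, update_of_ne hi.2]
    · congr 1
      have key : ∀ z w : ι → Fin 2, (∀ i, ¬i = c ∧ ¬i = t → z i = w i) →
          (z = update w t (w t + w c) ↔ z t = w t + w c ∧ z c = w c) := by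
        intro z w hzw
        constructor
        · rintro rfl
          simp [hct]
        · rintro ⟨h1, h2⟩
          ext1 i
          by_cases hit : i = t
          · subst hit; simpa using h1
          · by_cases hic : i = c
            · subst hic; simpa [hit] using h2
            · simpa [hit] using hzw i ⟨hic, hit⟩
      rw [key y x h, key y' x' h', hy t (Or.inr rfl), hy c (Or.inl rfl), hx t (Or.inr rfl),
        hx c (Or.inl rfl)]

theorem Gate.commute_of_disjoint {g g' : Gate ι} (h : Disjoint g.support g'.support) :
    Commute g.toMatrix g'.toMatrix :=
  g.actsOn.commute g'.actsOn h

/-! ### Basis permutations and controlled one-qubit operators -/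

/-- The operator that permutes the computational basis by `σ`. -/
def permOp (σ : (ι → Fin 2) → ι → Fin 2) : Matrix (ι → Fin 2) (ι → Fin 2) ℂ :=
  Matrix.of fun y x => if y = σ x then 1 else 0

theorem mul_permOp_apply (M : Matrix (ι → Fin 2) (ι → Fin 2) ℂ) (σ : (ι → Fin 2) → ι → Fin 2)
    (y x : ι → Fin 2) : (M * permOp σ) y x = M y (σ x) := by
  simp [permOp, Matrix.mul_apply]

theorem permOp_mul (σ τ : (ι → Fin 2) → ι → Fin 2) :
    permOp σ * permOp τ = permOp (σ ∘ τ) := by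
  ext y x
  rw [mul_permOp_apply]
  rfl

theorem permOp_id : permOp (id : (ι → Fin 2) → ι → Fin 2) = 1 := by
  ext y x
  simp [permOp, Matrix.one_apply]

theorem permOp_mul_diagonal_mul_permOp {σ : (ι → Fin 2) → ι → Fin 2} (hσ : Involutive σ)
    (φ : (ι → Fin 2) → ℂ) :
    permOp σ * Matrix.diagonal φ * permOp σ = Matrix.diagonal (φ ∘ σ) := by
  ext y x
  rw [mul_permOp_apply, Matrix.mul_diagonal]
  simp [permOp, Matrix.diagonal_apply, hσ x]
  grind

/-- The operator that acts on qubit `t` by the matrix `f x`, where `x` is the basis state. -/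
def blockOp (t : ι) (f : (ι → Fin 2) → Matrix (Fin 2) (Fin 2) ℂ) :
    Matrix (ι → Fin 2) (ι → Fin 2) ℂ :=
  Matrix.of fun y x => if ∀ j, j ≠ t → y j = x j then f x (y t) (x t) else 0

theorem eq_off_iff {t : ι} {y x : ι → Fin 2} :
    (∀ j, j ≠ t → y j = x j) ↔ y = update x t (y t) := by
  constructor
  · intro h
    ext1 j
    by_cases hj : j = t
    · subst hj; simp
    · simp [hj, h j hj]
  · intro h j hj
    rw [h]; simp [hj]

theorem sum_eq_off (t : ι) (x : ι → Fin 2) (h : (ι → Fin 2) → ℂ) :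
    ∑ z, (if ∀ j, j ≠ t → z j = x j then h z else 0) = ∑ b, h (update x t b) := by
  rw [← Finset.sum_filter]
  refine Finset.sum_bij' (fun z _ => z t) (fun b _ => update x t b) ?_ ?_ ?_ ?_ ?_
  · simp
  · intro b _
    simp +contextual
  · intro z hz
    exact (eq_off_iff.1 (Finset.mem_filter.1 hz).2).symm
  · simp
  · intro z hz
    rw [← eq_off_iff.1 (Finset.mem_filter.1 hz).2]

/-- The left factor reads its block from the intermediate state, which differs from `x` only at `t`;
hence `f` has to be independent of `t`, while `g` need not be. -/
theorem blockOp_mul {t : ι} {f g : (ι → Fin 2) → Matrix (Fin 2) (Fin 2) ℂ}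
    (hf : ∀ x v, f (update x t v) = f x) :
    blockOp t f * blockOp t g = blockOp t fun x => f x * g x := by
  ext y x
  simp only [Matrix.mul_apply, blockOp, Matrix.of_apply, mul_ite, mul_zero]
  rw [sum_eq_off t x (fun z => (if ∀ j, j ≠ t → y j = z j then f z (y t) (z t) else 0) *
    g x (z t) (x t))]
  have : ∀ b, (∀ j, j ≠ t → y j = update x t b j) ↔ ∀ j, j ≠ t → y j = x j := fun b =>
    forall₂_congr fun j hj => by rw [update_of_ne hj]
  simp only [this, hf, update_self]
  split_ifs <;> simp

theorem Gate.toMatrix_single (q : ι) (U : Matrix.unitaryGroup (Fin 2) ℂ) :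
    (Gate.single q U).toMatrix = blockOp q fun _ => (U : Matrix (Fin 2) (Fin 2) ℂ) := rfl

theorem blockOp_one (q : ι) : blockOp q (fun _ => 1) = 1 := by
  ext y x
  simp only [blockOp, Matrix.of_apply, Matrix.one_apply]
  by_cases h : y = x
  · simp [h]
  · rw [if_neg h]
    split_ifs with h1 h2
    · exact absurd (by rw [eq_off_iff.1 h1, h2, update_eq_self]) h
    · rfl
    · rfl

/-- Adds `f x` to qubit `t`. -/
def xorAt (t : ι) (f : (ι → Fin 2) → Fin 2) (x : ι → Fin 2) : ι → Fin 2 :=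
  update x t (x t + f x)

theorem xorAt_self (t : ι) (f : (ι → Fin 2) → Fin 2) (x : ι → Fin 2) :
    xorAt t f x t = x t + f x := update_self ..

theorem xorAt_of_ne {t q : ι} (h : q ≠ t) (f : (ι → Fin 2) → Fin 2) (x : ι → Fin 2) :
    xorAt t f x q = x q := update_of_ne h ..

theorem fin_two_add_add_self (a b : Fin 2) : a + b + b = a := by
  revert a b; decide

theorem xorAt_involutive {t : ι} {f : (ι → Fin 2) → Fin 2} (hf : ∀ x v, f (update x t v) = f x) :
    Involutive (xorAt t f) := by
  intro x
  simp [xorAt, hf, fin_two_add_add_self]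

theorem Gate.toMatrix_cnot (c t : ι) (h : c ≠ t) :
    (Gate.cnot c t h).toMatrix = permOp (xorAt t fun x => x c) := rfl

theorem Gate.exists_inverse (g : Gate ι) :
    ∃ g' : Gate ι, g'.support = g.support ∧ g'.toMatrix * g.toMatrix = 1 := by
  cases g with
  | single q U =>
    refine ⟨.single q U⁻¹, rfl, ?_⟩
    rw [Gate.toMatrix_single, Gate.toMatrix_single, blockOp_mul fun _ _ => rfl, ← blockOp_one q]
    congr
    funext _
    rw [← Submonoid.coe_mul]
    simp
  | cnot c t h =>
    refine ⟨.cnot c t h, rfl, ?_⟩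
    rw [Gate.toMatrix_cnot, permOp_mul,
      (xorAt_involutive fun x v => by rw [update_of_ne h]).comp_self, permOp_id]

/-! ### Circuits confined to a set of qubits: composition, inversion, parallelism -/

/-- Some circuit of depth at most `d` whose gates act within `A` has the operator `M`. -/
def Implements (A : Finset ι) (d : ℕ) (M : Matrix (ι → Fin 2) (ι → Fin 2) ℂ) : Prop :=
  ∃ C : List (Layer ι), (∀ L ∈ C, ∀ g ∈ L.gates, g.support ⊆ A) ∧
    QCircuit.toMatrix C = M ∧ C.length ≤ d

theorem QCircuit.toMatrix_nil : QCircuit.toMatrix ([] : List (Layer ι)) = 1 := rfl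

theorem QCircuit.toMatrix_cons (L : Layer ι) (C : List (Layer ι)) :
    QCircuit.toMatrix (L :: C : List (Layer ι)) = QCircuit.toMatrix C * L.toMatrix := rfl

theorem QCircuit.toMatrix_append (C D : List (Layer ι)) :
    QCircuit.toMatrix (C ++ D : List (Layer ι)) = QCircuit.toMatrix D * QCircuit.toMatrix C := by
  induction C with
  | nil => rw [List.nil_append, QCircuit.toMatrix_nil, mul_one]
  | cons L C ih => rw [List.cons_append, toMatrix_cons, ih, toMatrix_cons, mul_assoc]

namespace Implements

variable {A B : Finset ι} {d e : ℕ} {M N : Matrix (ι → Fin 2) (ι → Fin 2) ℂ}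

theorem mono (h : Implements A d M) (hA : A ⊆ B) (hd : d ≤ e) : Implements B e M := by
  obtain ⟨C, h1, h2, h3⟩ := h
  exact ⟨C, fun L hL g hg => (h1 L hL g hg).trans hA, h2, h3.trans hd⟩

theorem one : Implements A 0 (1 : Matrix (ι → Fin 2) (ι → Fin 2) ℂ) :=
  ⟨[], by simp, rfl, le_rfl⟩

theorem mul (hM : Implements A d M) (hN : Implements A e N) : Implements A (d + e) (M * N) := by
  obtain ⟨C, h1, rfl, h3⟩ := hM
  obtain ⟨D, k1, rfl, k3⟩ := hN
  refine ⟨D ++ C, ?_, QCircuit.toMatrix_append D C, by rw [List.length_append]; omega⟩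
  intro L hL
  rcases List.mem_append.1 hL with h | h
  exacts [k1 L h, h1 L h]

theorem gate (g : Gate ι) (h : g.support ⊆ A) : Implements A 1 g.toMatrix :=
  ⟨[⟨[g], List.pairwise_singleton _ _⟩], by simpa using h,
    by simp [QCircuit.toMatrix_cons, QCircuit.toMatrix_nil, Layer.toMatrix], le_rfl⟩

theorem exists_layer_inverse (L : Layer ι) (hL : ∀ g ∈ L.gates, g.support ⊆ A) :
    ∃ L' : Layer ι, (∀ g ∈ L'.gates, g.support ⊆ A) ∧ L'.toMatrix * L.toMatrix = 1 := by
  choose inv hsupp hinv using Gate.exists_inverse (ι := ι)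
  refine ⟨⟨(L.gates.map inv).reverse, ?_⟩, ?_, ?_⟩
  · rw [List.pairwise_reverse, List.pairwise_map]
    exact L.disjoint.imp fun h => by rw [hsupp, hsupp]; exact h.symm
  · intro g hg
    simp only [List.mem_reverse, List.mem_map] at hg
    obtain ⟨g, hg, rfl⟩ := hg
    rw [hsupp]
    exact hL g hg
  · simp only [Layer.toMatrix]
    induction L.gates with
    | nil => simp
    | cons g l ih =>
      simp only [List.map_cons, List.reverse_cons, List.map_append, List.prod_append,
        List.prod_cons, List.map_nil, List.prod_nil, mul_one] at ih ⊢
      rw [mul_assoc, ← mul_assoc _ g.toMatrix, hinv, one_mul, ih]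

theorem exists_inverse (h : Implements A d M) : ∃ M', Implements A d M' ∧ M' * M = 1 := by
  obtain ⟨C, h1, rfl, h3⟩ := h
  induction C generalizing d with
  | nil => exact ⟨1, one.mono subset_rfl (Nat.zero_le d), by rw [QCircuit.toMatrix_nil, one_mul]⟩
  | cons L C ih =>
    obtain ⟨M', hM', hinv⟩ := ih (fun L hL => h1 L (List.mem_cons_of_mem _ hL)) le_rfl
    obtain ⟨L', hL', hL'inv⟩ := exists_layer_inverse L (h1 L List.mem_cons_self)
    have hL1 : Implements A 1 L'.toMatrix :=
      ⟨[L'], by simpa using hL', by rw [QCircuit.toMatrix_cons, QCircuit.toMatrix_nil, one_mul],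
        le_rfl⟩
    refine ⟨_, (hL1.mul hM').mono subset_rfl (by rw [List.length_cons] at h3; omega), ?_⟩
    rw [QCircuit.toMatrix_cons, mul_assoc, ← mul_assoc M', hinv, one_mul, hL'inv]

theorem commute_of_disjoint (hAB : Disjoint A B) {C : List (Layer ι)} {L : Layer ι}
    (hC : ∀ L ∈ C, ∀ g ∈ L.gates, g.support ⊆ A) (hL : ∀ g ∈ L.gates, g.support ⊆ B) :
    Commute (QCircuit.toMatrix C) L.toMatrix := by
  induction C with
  | nil => rw [QCircuit.toMatrix_nil]; exact Commute.one_left _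
  | cons L' C ih =>
    rw [QCircuit.toMatrix_cons]
    refine (ih fun L hL => hC L (List.mem_cons_of_mem _ hL)).mul_left ?_
    refine Commute.list_prod_left _ _ fun M hM => Commute.list_prod_right _ _ fun N hN => ?_
    obtain ⟨g, hg, rfl⟩ := List.mem_map.1 hM
    obtain ⟨g', hg', rfl⟩ := List.mem_map.1 hN
    exact Gate.commute_of_disjoint
      (Disjoint.mono (hC L' List.mem_cons_self g hg) (hL g' hg') hAB)

/-- Circuits on disjoint sets of qubits can be run in parallel. -/
theorem mul_of_disjoint (hM : Implements A d M) (hN : Implements B d N) (hAB : Disjoint A B) :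
    Implements (A ∪ B) d (M * N) := by
  obtain ⟨C, h1, rfl, h3⟩ := hM
  obtain ⟨D, k1, rfl, k3⟩ := hN
  induction C generalizing d D with
  | nil =>
    rw [QCircuit.toMatrix_nil, one_mul]
    exact Implements.mono ⟨D, k1, rfl, k3⟩ Finset.subset_union_right le_rfl
  | cons L C ih =>
    cases D with
    | nil =>
      rw [QCircuit.toMatrix_nil, mul_one]
      exact Implements.mono ⟨L :: C, h1, rfl, h3⟩ Finset.subset_union_left le_rfl
    | cons L' D =>
      have hL := h1 L List.mem_cons_self
      have hL' := k1 L' List.mem_cons_self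
      have hC : ∀ L ∈ C, ∀ g ∈ L.gates, g.support ⊆ A :=
        fun L hL => h1 L (List.mem_cons_of_mem _ hL)
      rw [List.length_cons] at h3 k3
      obtain ⟨E, e1, e2, e3⟩ := ih (d := d - 1) hC (by omega) D
        (fun L hL => k1 L (List.mem_cons_of_mem _ hL)) (by omega)
      let P : Layer ι := ⟨L.gates ++ L'.gates, List.pairwise_append.2 ⟨L.disjoint, L'.disjoint,
        fun g hg g' hg' => Disjoint.mono (hL g hg) (hL' g' hg') hAB⟩⟩
      refine ⟨P :: E, ?_, ?_, by rw [List.length_cons]; omega⟩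
      · intro K hK
        rcases List.mem_cons.1 hK with rfl | hK
        · intro g hg
          rcases List.mem_append.1 hg with hg | hg
          · exact (hL g hg).trans Finset.subset_union_left
          · exact (hL' g hg).trans Finset.subset_union_right
        · exact e1 K hK
      · have hP : P.toMatrix = L.toMatrix * L'.toMatrix := by
          simp [P, Layer.toMatrix]
        have hcomm : Commute (QCircuit.toMatrix D) L.toMatrix :=
          commute_of_disjoint hAB.symm (fun L hL => k1 L (List.mem_cons_of_mem _ hL)) hL
        rw [QCircuit.toMatrix_cons, QCircuit.toMatrix_cons, QCircuit.toMatrix_cons, e2, hP]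
        simp only [mul_assoc]
        rw [← mul_assoc (QCircuit.toMatrix D), hcomm.eq, mul_assoc]

end Implements

/-! ### Exact synthesis of the Toffoli gate -/

theorem permOp_xorAt (t : ι) (f : (ι → Fin 2) → Fin 2) :
    permOp (xorAt t f) = blockOp t fun x => if f x = 1 then !![0, 1; 1, 0] else 1 := by
  ext y x
  simp only [permOp, blockOp, Matrix.of_apply]
  have hy : y = xorAt t f x ↔ (∀ j, j ≠ t → y j = x j) ∧ y t = x t + f x := by
    rw [eq_off_iff, xorAt]
    constructor
    · intro h
      rw [h]
      simp
    · rintro ⟨h1, h2⟩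
      rw [h1, h2]
  rw [if_congr hy rfl rfl]
  by_cases hoff : ∀ j, j ≠ t → y j = x j
  · rw [if_pos hoff, if_congr (and_iff_right hoff) rfl rfl]
    generalize y t = k, x t = l, f x = i
    fin_cases i <;> fin_cases k <;> fin_cases l <;> simp
  · rw [if_neg hoff, if_neg (fun h => hoff h.1)]

namespace Implements

variable {A : Finset ι} {d : ℕ}

theorem phase {q : ι} (hq : q ∈ A) {u : ℂ} (hu : star u * u = 1) :
    Implements A 1 (Matrix.diagonal fun x : ι → Fin 2 => if x q = 1 then u else 1) := by
  have hU : Matrix.diagonal ![1, u] ∈ Matrix.unitaryGroup (Fin 2) ℂ := by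
    rw [Matrix.mem_unitaryGroup_iff', Matrix.star_eq_conjTranspose, Matrix.diagonal_conjTranspose,
      Matrix.diagonal_mul_diagonal, ← Matrix.diagonal_one]
    congr 1
    ext i
    fin_cases i
    · simp
    · simpa using hu
  convert Implements.gate (.single q ⟨_, hU⟩) (by simpa [Gate.support] using hq) using 1
  rw [Gate.toMatrix_single]
  ext y x
  simp only [blockOp, Matrix.of_apply, Matrix.diagonal_apply]
  by_cases h : y = x
  · subst h
    have : ∀ b : Fin 2, (if b = 1 then u else 1) = ![1, u] b := by
      intro b; fin_cases b <;> simp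
    simp [this]
  · rw [if_neg h]
    split_ifs with h1 h2
    · exact absurd (by rw [eq_off_iff.1 h1, h2, update_eq_self]) h
    · rfl
    · rfl

/-- Conjugation by a CNOT substitutes a sum of bits for a bit in the phase function, so phases of
parities come from one-qubit phases. -/
theorem diagonal_comp_cnot {φ : (ι → Fin 2) → ℂ} (h : Implements A d (Matrix.diagonal φ))
    {c t : ι} (hc : c ∈ A) (ht : t ∈ A) (hct : c ≠ t) :
    Implements A (d + 2) (Matrix.diagonal (φ ∘ xorAt t fun x => x c)) := by
  have hg := Implements.gate (A := A) (.cnot c t hct)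
    (by simp [Gate.support, Finset.insert_subset_iff, hc, ht])
  rw [Gate.toMatrix_cnot] at hg
  rw [← permOp_mul_diagonal_mul_permOp
    (xorAt_involutive (f := fun x => x c) fun x v => by rw [update_of_ne hct])]
  exact ((hg.mul h).mul hg).mono subset_rfl (by omega)

theorem parity_phase {a b : ι} (ha : a ∈ A) (hb : b ∈ A) (hab : a ≠ b) {u : ℂ}
    (hu : star u * u = 1) :
    Implements A 3 (Matrix.diagonal fun x : ι → Fin 2 => if x a + x b = 1 then u else 1) := by
  convert (phase hb hu).diagonal_comp_cnot ha hb hab using 3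
  simp [xorAt_self, add_comm]

theorem parity_three_phase {a b c : ι} (ha : a ∈ A) (hb : b ∈ A) (hc : c ∈ A) (hac : a ≠ c)
    (hbc : b ≠ c) {u : ℂ} (hu : star u * u = 1) :
    Implements A 5
      (Matrix.diagonal fun x : ι → Fin 2 => if x a + x b + x c = 1 then u else 1) := by
  convert ((phase hc hu).diagonal_comp_cnot ha hc hac).diagonal_comp_cnot hb hc hbc using 3
  simp [xorAt_self, xorAt_of_ne hac, add_comm, add_left_comm]

/-- The doubly controlled `Z` gate, from `4abc = a + b + c - (a⊕b) - (a⊕c) - (b⊕c) + (a⊕b⊕c)`. -/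
theorem ccz {a b c : ι} (ha : a ∈ A) (hb : b ∈ A) (hc : c ∈ A) (hab : a ≠ b) (hac : a ≠ c)
    (hbc : b ≠ c) :
    Implements A 17
      (Matrix.diagonal fun x : ι → Fin 2 => if x a = 1 ∧ x b = 1 ∧ x c = 1 then -1 else 1) := by
  -- With `u` a primitive eighth root of unity, each monomial of the parity expansion becomes a
  -- power of `u` or its conjugate, and `u ^ 4 = -1` produces the sign.
  obtain ⟨u, hu, hu4⟩ : ∃ u : ℂ, star u * u = 1 ∧ u ^ 4 = -1 := by
    refine ⟨Complex.exp (Real.pi / 4 * Complex.I), ?_, ?_⟩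
    · rw [Complex.star_def, ← Complex.exp_conj, ← Complex.exp_add, map_mul, map_div₀,
        Complex.conj_ofReal, Complex.conj_I, Complex.conj_ofNat, mul_neg, neg_add_cancel,
        Complex.exp_zero]
    · rw [← Complex.exp_nat_mul, ← Complex.exp_pi_mul_I]
      congr 1
      push_cast
      ring
  have hv : star (star u) * star u = 1 := by rw [star_star, mul_comm, hu]
  convert ((((((phase ha hu).mul (phase hb hu)).mul (phase hc hu)).mul
    (parity_phase ha hb hab hv)).mul (parity_phase ha hc hac hv)).mul
    (parity_phase hb hc hbc hv)).mul (parity_three_phase ha hb hc hac hbc hu) using 1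
  simp only [Matrix.diagonal_mul_diagonal]
  congr 1
  ext x
  generalize x a = i, x b = j, x c = k
  generalize star u = w at hu
  have h1 : u * w = 1 := by rw [mul_comm, hu]
  have h2 : u * u * w * w = 1 := by linear_combination (u * w + 1) * h1
  have h3 : u * u * u * u = -1 := by rw [← hu4]; ring
  fin_cases i <;> fin_cases j <;> fin_cases k <;> simp [h1, h2, h3, hu]

theorem toffoli {a b t : ι} (ha : a ∈ A) (hb : b ∈ A) (ht : t ∈ A) (hab : a ≠ b) (hat : a ≠ t)
    (hbt : b ≠ t) : Implements A 19 (permOp (xorAt t fun x => x a * x b)) := by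
  let s : ℂ := (Real.sqrt 2 / 2 : ℝ)
  have hss : s * s = 1 / 2 := by
    simp only [s, ← Complex.ofReal_mul]
    rw [div_mul_div_comm, Real.mul_self_sqrt (by norm_num)]
    norm_num
  have hstar : star s = s := Complex.conj_ofReal _
  let H : Matrix (Fin 2) (Fin 2) ℂ := !![s, s; s, -s]
  have hHH : H * H = 1 := by
    ext i j
    fin_cases i <;> fin_cases j <;> simp [H, Matrix.mul_apply, hss] <;> norm_num
  have hHZ : H * !![1, 0; 0, -1] * H = !![0, 1; 1, 0] := by
    ext i j
    fin_cases i <;> fin_cases j <;> simp [H, Matrix.mul_apply, hss] <;> norm_num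
  have hH : H ∈ Matrix.unitaryGroup (Fin 2) ℂ := by
    have : star H = H := by
      ext i j
      fin_cases i <;> fin_cases j <;>
        simp [H, Matrix.star_apply, - Complex.star_def, hstar]
    rw [Matrix.mem_unitaryGroup_iff', this, hHH]
  have hg := Implements.gate (A := A) (.single t ⟨H, hH⟩) (by simpa [Gate.support] using ht)
  rw [Gate.toMatrix_single] at hg
  -- On `t` the doubly controlled phase is either Z or the identity; conjugation by the Hadamard
  -- matrix `H` turns Z into X and keeps the identity.
  convert (hg.mul (ccz ha hb ht hab hat hbt)).mul hg using 1
  have hD : (Matrix.diagonal fun x : ι → Fin 2 => if x a = 1 ∧ x b = 1 ∧ x t = 1 then (-1 : ℂ)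
      else 1) = blockOp t fun x => if x a = 1 ∧ x b = 1 then !![1, 0; 0, -1] else 1 := by
    ext y x
    simp only [blockOp, Matrix.of_apply, Matrix.diagonal_apply]
    by_cases h : y = x
    · subst h
      generalize y t = k
      by_cases h : y a = 1 ∧ y b = 1
      · simp only [h.1, h.2]
        fin_cases k <;> simp
      · rw [if_pos rfl, if_neg (by tauto)]
        simp [h]
    · rw [if_neg h]
      split_ifs with h1 h2
      · have h3 : y t ≠ x t := fun h3 => h (by rw [eq_off_iff.1 h1, h3, update_eq_self])
        generalize y t = k, x t = l at h3
        fin_cases k <;> fin_cases l <;> simp_all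
      · have h3 : y t ≠ x t := fun h3 => h (by rw [eq_off_iff.1 h1, h3, update_eq_self])
        rw [Matrix.one_apply_ne h3]
      · rfl
  rw [hD, mul_assoc, blockOp_mul (by simp [hat, hbt]), blockOp_mul (fun _ _ => rfl)]
  have hX : ∀ x : ι → Fin 2, (H * ((if x a = 1 ∧ x b = 1 then !![1, 0; 0, -1] else 1) * H)) =
      if x a = 1 ∧ x b = 1 then !![0, 1; 1, 0] else 1 := by
    intro x
    split_ifs
    · rw [← mul_assoc, hHZ]
    · rw [one_mul, hHH]
  simp only [hX]
  rw [permOp_xorAt]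
  congr
  funext x
  have : ∀ i j : Fin 2, i * j = 1 ↔ i = 1 ∧ j = 1 := by decide
  simp only [this]

theorem bitFlip {t : ι} (ht : t ∈ A) : Implements A 1 (permOp (xorAt t fun _ => 1)) := by
  have hX : !![0, 1; 1, 0] ∈ Matrix.unitaryGroup (Fin 2) ℂ := by
    rw [Matrix.mem_unitaryGroup_iff']
    ext i j
    fin_cases i <;> fin_cases j <;> simp [Matrix.mul_apply, Matrix.star_apply]
  convert Implements.gate (.single t ⟨_, hX⟩) (by simpa [Gate.support] using ht) using 1
  rw [Gate.toMatrix_single, permOp_xorAt]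
  simp

theorem cnot {c t : ι} (hc : c ∈ A) (ht : t ∈ A) (hct : c ≠ t) :
    Implements A 1 (permOp (xorAt t fun x => x c)) :=
  Implements.gate (.cnot c t hct) (by simp [Gate.support, Finset.insert_subset_iff, hc, ht])

end Implements

/-! ### Circuits as reversible maps on bit strings -/

/-- Some circuit of depth at most `d` whose gates act within `A` permutes the computational basis
by `σ`. -/
structure Realizes (A : Finset ι) (d : ℕ) (σ : (ι → Fin 2) → ι → Fin 2) : Prop where
  implements : Implements A d (permOp σ)
  update_comm : ∀ q, q ∉ A → ∀ x v, σ (update x q v) = update (σ x) q v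

/-- Supplies the field `update_comm` for elementary gates. That field makes outside qubits
spectators of the basis map, so a target may be changed between a circuit and its inverse. -/
theorem xorAt_update_comm {t q : ι} (h : q ≠ t) {f : (ι → Fin 2) → Fin 2}
    (hf : ∀ x v, f (update x q v) = f x) (x : ι → Fin 2) (v : Fin 2) :
    xorAt t f (update x q v) = update (xorAt t f x) q v := by
  rw [xorAt, xorAt, hf, update_of_ne h.symm, update_comm h.symm]

namespace Realizes

variable {A B : Finset ι} {d e : ℕ} {σ τ : (ι → Fin 2) → ι → Fin 2}

theorem apply_of_notMem (h : Realizes A d σ) {q : ι} (hq : q ∉ A) (x : ι → Fin 2) :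
    σ x q = x q := by
  have := congrFun (h.update_comm q hq x (x q)) q
  rwa [update_eq_self, update_self] at this

theorem mono (h : Realizes A d σ) (hA : A ⊆ B) (hd : d ≤ e) : Realizes B e σ :=
  ⟨h.1.mono hA hd, fun q hq => h.2 q fun hq' => hq (hA hq')⟩

theorem id : Realizes A 0 (id : (ι → Fin 2) → ι → Fin 2) :=
  ⟨by rw [permOp_id]; exact Implements.one, fun _ _ _ _ => rfl⟩

theorem comp (hσ : Realizes A d σ) (hτ : Realizes A e τ) : Realizes A (d + e) (σ ∘ τ) :=
  ⟨by rw [← permOp_mul]; exact hσ.1.mul hτ.1,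
    fun q hq x v => by rw [comp_apply, hτ.2 q hq, hσ.2 q hq, comp_apply]⟩

theorem comp_of_disjoint (hσ : Realizes A d σ) (hτ : Realizes B d τ) (h : Disjoint A B) :
    Realizes (A ∪ B) d (σ ∘ τ) :=
  ⟨by rw [← permOp_mul]; exact hσ.1.mul_of_disjoint hτ.1 h,
    fun q hq x v => by
      rw [Finset.mem_union, not_or] at hq
      rw [comp_apply, hτ.2 q hq.2, hσ.2 q hq.1, comp_apply]⟩

/-- The inverse circuit is known only as a matrix. A left inverse of `permOp σ` forces `σ` to be
injective, hence bijective on a finite set, and that matrix must then be the permutation operator of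
the inverse map. -/
theorem exists_inverse (h : Realizes A d σ) :
    ∃ τ, Realizes A d τ ∧ LeftInverse τ σ ∧ Function.RightInverse τ σ := by
  obtain ⟨M, hM, hinv⟩ := h.1.exists_inverse
  have hinj : Injective σ := by
    intro x y hxy
    have h1 : ∀ z, (1 : Matrix (ι → Fin 2) (ι → Fin 2) ℂ) x z = M x (σ z) := fun z => by
      rw [← hinv, mul_permOp_apply]
    have h2 := h1 y
    rw [← hxy, ← h1 x, Matrix.one_apply_eq, Matrix.one_apply] at h2
    by_contra hne
    simp [hne] at h2
  obtain ⟨τ, hτ, hτ'⟩ := bijective_iff_has_inverse.1 (Finite.injective_iff_bijective.1 hinj)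
  refine ⟨τ, ⟨?_, fun q hq x v => ?_⟩, hτ, hτ'⟩
  · have : permOp τ = M := by
      calc permOp τ = M * permOp σ * permOp τ := by rw [hinv, one_mul]
        _ = M := by rw [mul_assoc, permOp_mul, hτ'.comp_eq_id, permOp_id, mul_one]
    rwa [this]
  · apply hinj
    rw [hτ', h.2 q hq, hτ']

theorem toffoli {a b t : ι} (ha : a ∈ A) (hb : b ∈ A) (ht : t ∈ A) (hab : a ≠ b) (hat : a ≠ t)
    (hbt : b ≠ t) : Realizes A 19 (xorAt t fun x => x a * x b) :=
  ⟨Implements.toffoli ha hb ht hab hat hbt, fun q hq => xorAt_update_comm (by grind) fun x v => by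
    rw [update_of_ne (by grind), update_of_ne (by grind)]⟩

theorem cnot {c t : ι} (hc : c ∈ A) (ht : t ∈ A) (hct : c ≠ t) :
    Realizes A 1 (xorAt t fun x => x c) :=
  ⟨Implements.cnot hc ht hct, fun q hq => xorAt_update_comm (by grind) fun x v => by
    rw [update_of_ne (by grind)]⟩

theorem bitFlip {t : ι} (ht : t ∈ A) : Realizes A 1 (xorAt t fun _ => 1) :=
  ⟨Implements.bitFlip ht, fun q hq => xorAt_update_comm (by grind) fun x v => rfl⟩

end Realizes

/-- Flips all qubits in `S`. -/
def flipAll (S : Finset ι) (x : ι → Fin 2) (q : ι) : Fin 2 := if q ∈ S then x q + 1 else x q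

theorem Realizes.flipAll (S : Finset ι) : Realizes S 1 (flipAll S) := by
  induction S using Finset.induction with
  | empty =>
    have h : _root_.flipAll (∅ : Finset ι) = _root_.id := by
      ext x q
      simp [_root_.flipAll]
    rw [h]
    exact Realizes.id.mono subset_rfl (Nat.zero_le 1)
  | insert a S ha ih =>
    have h : _root_.flipAll (insert a S) = xorAt a (fun _ => 1) ∘ _root_.flipAll S := by
      ext1 x
      ext1 q
      by_cases hq : q = a
      · subst hq
        simp [_root_.flipAll, xorAt, ha]
      · simp [_root_.flipAll, xorAt, hq]
    rw [h, Finset.insert_eq]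
    exact (Realizes.bitFlip (Finset.mem_singleton_self a)).comp_of_disjoint ih
      (Finset.disjoint_singleton_left.2 ha)

/-! ### Conjunctions of bits -/

/-- The conjunction of the bits in `S`. -/
def allOne (S : Finset ι) (x : ι → Fin 2) : Fin 2 := if ∀ c ∈ S, x c = 1 then 1 else 0

theorem allOne_eq_one_iff {S : Finset ι} {x : ι → Fin 2} :
    allOne S x = 1 ↔ ∀ c ∈ S, x c = 1 := by
  simp [allOne]

theorem fin_two_eq_iff {a b : Fin 2} : a = b ↔ (a = 1 ↔ b = 1) := by
  revert a b; decide

theorem fin_two_mul_eq_one_iff {a b : Fin 2} : a * b = 1 ↔ a = 1 ∧ b = 1 := by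
  revert a b; decide

theorem allOne_update {S : Finset ι} {q : ι} (hq : q ∉ S) (x : ι → Fin 2) (v : Fin 2) :
    allOne S (update x q v) = allOne S x := by
  rw [fin_two_eq_iff, allOne_eq_one_iff, allOne_eq_one_iff]
  exact forall₂_congr fun c hc => by rw [update_of_ne (by grind)]

theorem allOne_congr {S : Finset ι} {x y : ι → Fin 2} (h : ∀ q ∈ S, x q = y q) :
    allOne S x = allOne S y := by
  rw [fin_two_eq_iff, allOne_eq_one_iff, allOne_eq_one_iff]
  exact forall₂_congr fun c hc => by rw [h c hc]

theorem allOne_union (S T : Finset ι) (x : ι → Fin 2) :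
    allOne (S ∪ T) x = allOne S x * allOne T x := by
  rw [fin_two_eq_iff, fin_two_mul_eq_one_iff]
  simp only [allOne_eq_one_iff]
  grind

theorem allOne_singleton (a : ι) (x : ι → Fin 2) : allOne {a} x = x a := by
  rw [fin_two_eq_iff, allOne_eq_one_iff]
  simp

theorem allOne_insert (a : ι) (S : Finset ι) (x : ι → Fin 2) :
    allOne (insert a S) x = x a * allOne S x := by
  rw [Finset.insert_eq, allOne_union, allOne_singleton]

theorem mcx_eq_permOp (S : Finset ι) (t : ι) : mcx S t = permOp (xorAt t (allOne S)) := by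
  ext y x
  simp only [mcx, permOp, Matrix.of_apply]
  congr 2
  simp only [xorAt, allOne]
  split_ifs <;> simp

/-! ### The commutator with a borrowed qubit, and quadratic depth -/

/-- The target receives `(d + f) * g` and then `d * g`, whose sum modulo two is `f * g`. The unknown
value of `d` drops out, and `d` is restored because `f` is added to it twice. -/
theorem xorAt_commutator {t d : ι} (h : t ≠ d) {f g : (ι → Fin 2) → Fin 2}
    (hft : ∀ x v, f (update x t v) = f x) (hfd : ∀ x v, f (update x d v) = f x)
    (hgt : ∀ x v, g (update x t v) = g x) (hgd : ∀ x v, g (update x d v) = g x) :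
    (xorAt t (fun x => x d * g x) ∘ xorAt d f) ∘ (xorAt t (fun x => x d * g x) ∘ xorAt d f) =
      xorAt t fun x => f x * g x := by
  have key : ∀ a b c e : Fin 2, a + (b + c) * e + (b + c + c) * e = a + c * e := by decide
  ext1 x
  ext1 q
  by_cases hqt : q = t
  · subst hqt
    simp [xorAt, hft, hfd, hgt, hgd, h, h.symm, key]
  · by_cases hqd : q = d
    · subst hqd
      simp [xorAt, hft, hfd, h.symm, fin_two_add_add_self]
    · simp [xorAt, hqt, hqd]

/-- Halving the controls costs `T(j) = 2 (T(j1) + T(j2))` with `j = j1 + j2`. The shift by one in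
`S.card = j + 1` accounts for the borrowed qubit that becomes a control of the second gate. -/
theorem Realizes.xorAt_allOne_of_two_le (j : ℕ) (hj : 1 ≤ j) :
    ∀ (S : Finset ι) (t : ι), S.card = j + 1 → t ∉ S → j + 3 ≤ Fintype.card ι →
      Realizes Finset.univ (57 * j ^ 2 - 19) (xorAt t (allOne S)) := by
  induction j using Nat.strong_induction_on with
  | _ j ih =>
  intro S t hS ht hι
  rcases hj.eq_or_lt with rfl | hj
  · obtain ⟨a, b, hab, rfl⟩ := Finset.card_eq_two.1 hS
    simp only [Finset.mem_insert, Finset.mem_singleton, not_or] at ht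
    convert Realizes.toffoli (A := Finset.univ) (Finset.mem_univ a) (Finset.mem_univ b)
      (Finset.mem_univ t) hab (Ne.symm ht.1) (Ne.symm ht.2) |>.mono (e := 57 * 1 ^ 2 - 19)
      subset_rfl (by norm_num) using 2
    ext1 x
    rw [allOne_insert, allOne_singleton]
  · obtain ⟨j1, j2, h1, h2, hsum, hd⟩ : ∃ j1 j2, 1 ≤ j1 ∧ 1 ≤ j2 ∧ j1 + j2 = j ∧
        (j1 = j2 ∨ j2 = j1 + 1) := ⟨j / 2, j - j / 2, by omega, by omega, by omega, by omega⟩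
    obtain ⟨S1, hS1, hc1⟩ := Finset.exists_subset_card_eq (s := S) (n := j1 + 1) (by omega)
    have hc2 : (S \ S1).card = j2 := by rw [Finset.card_sdiff_of_subset hS1]; omega
    -- Any idle qubit can be borrowed, in the recursive calls even one of the other controls.
    obtain ⟨d, hd'⟩ : ∃ d, d ∉ insert t S := by
      by_contra! hall
      have := Finset.card_le_card (fun i _ => hall i : Finset.univ ⊆ insert t S)
      rw [Finset.card_insert_of_notMem ht, Finset.card_univ] at this
      omega
    rw [Finset.mem_insert, not_or] at hd'
    have hd2 : d ∉ S \ S1 := fun h => hd'.2 (Finset.sdiff_subset h)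
    have ht2 : t ∉ S \ S1 := fun h => ht (Finset.sdiff_subset h)
    have hT := ih j2 (by omega) h2 (insert d (S \ S1)) t
      (by rw [Finset.card_insert_of_notMem hd2, hc2])
      (by rw [Finset.mem_insert, not_or]; exact ⟨Ne.symm hd'.1, ht2⟩) (by omega)
    have hW := ih j1 (by omega) h1 S1 d hc1 (fun h => hd'.2 (hS1 h)) (by omega)
    have hfun : allOne (insert d (S \ S1)) = fun x => x d * allOne (S \ S1) x :=
      funext fun x => allOne_insert _ _ x
    rw [hfun] at hT
    have := (hT.comp hW).comp (hT.comp hW)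
    rw [xorAt_commutator (Ne.symm hd'.1) (allOne_update fun h => ht (hS1 h))
      (allOne_update fun h => hd'.2 (hS1 h)) (allOne_update ht2) (allOne_update hd2)] at this
    simp only [← allOne_union, Finset.union_sdiff_of_subset hS1] at this
    refine this.mono subset_rfl ?_
    have e1 : 1 ≤ j1 ^ 2 := Nat.one_le_pow _ _ h1
    have e2 : 1 ≤ j2 ^ 2 := Nat.one_le_pow _ _ h2
    -- Equality holds for odd `j`. The excess `57` is paid by the offset: four copies of `-19`
    -- become one, which is why `57 = 3 * 19`.
    have e3 : 2 * (j1 ^ 2 + j2 ^ 2) ≤ j ^ 2 + 1 := by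
      rcases hd with rfl | rfl <;> subst hsum <;> nlinarith
    omega

/-- The multi-controlled `X` gate in quadratic depth, given one qubit to spare. -/
theorem Realizes.xorAt_allOne (S : Finset ι) (t : ι) (ht : t ∉ S)
    (hι : S.card + 2 ≤ Fintype.card ι) :
    Realizes Finset.univ (57 * S.card ^ 2 + 1) (xorAt t (allOne S)) := by
  rcases hS : S.card with _ | _ | j
  · rw [Finset.card_eq_zero] at hS
    subst hS
    have hfun : allOne (∅ : Finset ι) = fun _ => 1 := funext fun x => by simp [allOne]
    rw [hfun]
    exact (Realizes.bitFlip (Finset.mem_univ t)).mono subset_rfl (by omega)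
  · obtain ⟨a, rfl⟩ := Finset.card_eq_one.1 hS
    have hfun : allOne ({a} : Finset ι) = fun x => x a := funext fun x => allOne_singleton a x
    rw [hfun]
    exact (Realizes.cnot (Finset.mem_univ a) (Finset.mem_univ t)
      (by rw [Finset.mem_singleton] at ht; exact Ne.symm ht)).mono subset_rfl (by omega)
  · exact (Realizes.xorAt_allOne_of_two_le (j + 1) (by omega) S t hS ht (by omega)).mono subset_rfl
      (by have : (j + 1) ^ 2 ≤ (j + 1 + 1) ^ 2 := Nat.pow_le_pow_left (by omega) 2
          omega)

/-! ### Toffoli trees and the doubling supply of ones -/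

/-- A balanced tree of Toffoli gates collects the conjunction of `C` in one qubit, given clean
qubits `S`; if the conjunction is one, all the clean qubits end up as ones. -/
theorem exists_and_tree (e : ℕ) : ∀ C S : Finset ι, Disjoint C S → C.card = S.card + 1 →
    C.card ≤ 2 ^ e → ∃ σ r, r ∈ C ∪ S ∧ Realizes (C ∪ S) (19 * e) σ ∧
      (∀ x q, q ∉ S → σ x q = x q) ∧
      ∀ x, (∀ q ∈ S, x q = 0) →
        σ x r = allOne C x ∧ (allOne C x = 1 → ∀ q ∈ S, σ x q = 1) := by
  have base : ∀ e, ∀ C S : Finset ι, C.card = S.card + 1 → C.card ≤ 1 →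
      ∃ σ r, r ∈ C ∪ S ∧ Realizes (C ∪ S) (19 * e) σ ∧
      (∀ x q, q ∉ S → σ x q = x q) ∧
      ∀ x, (∀ q ∈ S, x q = 0) →
        σ x r = allOne C x ∧ (allOne C x = 1 → ∀ q ∈ S, σ x q = 1) := by
    intro e C S hcard hC
    obtain ⟨r, rfl⟩ := Finset.card_eq_one.1 (by omega : C.card = 1)
    obtain rfl := Finset.card_eq_zero.1 (by omega : S.card = 0)
    exact ⟨id, r, by simp, Realizes.id.mono subset_rfl (by omega), fun _ _ _ => rfl,
      fun x _ => ⟨(allOne_singleton r x).symm, by simp⟩⟩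
  induction e with
  | zero => exact fun C S _ hcard hC => base 0 C S hcard hC
  | succ e ih =>
    intro C S hdisj hcard hC
    by_cases hle : C.card ≤ 1
    · exact base _ C S hcard hle
    obtain ⟨C1, hC1, hc1⟩ := Finset.exists_subset_card_eq (s := C) (n := C.card / 2) (by omega)
    have hc2 : (C \ C1).card = C.card - C.card / 2 := by
      rw [Finset.card_sdiff_of_subset hC1]; omega
    set C2 := C \ C1 with hC2
    obtain ⟨s, hs⟩ := Finset.card_pos.1 (by omega : 0 < S.card)
    have hSe := Finset.card_erase_of_mem hs
    -- One clean qubit `s` is kept for the root; each half of the controls gets one clean qubit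
    -- fewer than its size.
    obtain ⟨S1, hS1, hs1⟩ := Finset.exists_subset_card_eq (s := S.erase s)
      (n := C.card / 2 - 1) (by omega)
    have hs2 : (S.erase s \ S1).card = C.card - C.card / 2 - 1 := by
      rw [Finset.card_sdiff_of_subset hS1]; omega
    set S2 := S.erase s \ S1 with hS2
    have hCS : ∀ q, q ∈ C → q ∉ S := fun _ h => Finset.disjoint_left.1 hdisj h
    have m1 : ∀ q, q ∈ C1 → q ∈ C := fun q h => hC1 h
    have m2 : ∀ q, q ∈ C2 ↔ q ∈ C ∧ q ∉ C1 := fun q => Finset.mem_sdiff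
    have m3 : ∀ q, q ∈ S1 → q ≠ s ∧ q ∈ S := fun q h => Finset.mem_erase.1 (hS1 h)
    have m4 : ∀ q, q ∈ S2 ↔ (q ≠ s ∧ q ∈ S) ∧ q ∉ S1 := fun q => by
      rw [hS2, Finset.mem_sdiff, Finset.mem_erase]
    clear_value C2 S2
    have hp : 2 ^ (e + 1) = 2 * 2 ^ e := by ring
    obtain ⟨σ1, r1, hr1, hR1, hoff1, hon1⟩ := ih C1 S1 (by
      rw [Finset.disjoint_left]; grind) (by omega) (by omega)
    obtain ⟨σ2, r2, hr2, hR2, hoff2, hon2⟩ := ih C2 S2 (by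
      rw [Finset.disjoint_left]; grind) (by omega) (by omega)
    have hd12 : Disjoint (C1 ∪ S1) (C2 ∪ S2) := by
      rw [Finset.disjoint_left]
      intro q hq hq'
      rw [Finset.mem_union] at hq hq'
      grind
    rw [Finset.mem_union] at hr1 hr2
    have hr12 : r1 ≠ r2 := by grind
    have hr1s : r1 ≠ s := by grind
    have hr2s : r2 ≠ s := by grind
    have hs1' : s ∉ S1 := fun h => (m3 s h).1 rfl
    have hs2' : s ∉ S2 := fun h => ((m4 s).1 h).1.1 rfl
    have hT : Realizes (C ∪ S) 19 (xorAt s fun x => x r1 * x r2) := by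
      apply Realizes.toffoli _ _ _ hr12 hr1s hr2s <;> rw [Finset.mem_union] <;> grind
    refine ⟨xorAt s (fun x => x r1 * x r2) ∘ (σ1 ∘ σ2), s, Finset.mem_union_right _ hs,
      (hT.comp ((hR1.comp_of_disjoint hR2 hd12).mono ?_ le_rfl)).mono subset_rfl (by omega),
      ?_, ?_⟩
    · intro q hq
      simp only [Finset.mem_union] at hq ⊢
      grind
    · intro x q hq
      rw [comp_apply, xorAt_of_ne (by grind), comp_apply, hoff1 _ _ (by grind),
        hoff2 _ _ (by grind)]
    · intro x hx
      have hy : ∀ q, q ∉ S2 → σ2 x q = x q := hoff2 x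
      obtain ⟨v1, w1⟩ := hon1 (σ2 x) fun q hq => by rw [hy q (by grind), hx q (m3 q hq).2]
      obtain ⟨v2, w2⟩ := hon2 x fun q hq => hx q ((m4 q).1 hq).1.2
      rw [allOne_congr (fun q hq => hy q (by grind) : ∀ q ∈ C1, σ2 x q = x q)] at v1 w1
      have hvr2 : σ1 (σ2 x) r2 = allOne C2 x := by rw [hoff1 _ _ (by grind), v2]
      have hCeq : allOne C x = allOne C1 x * allOne C2 x := by
        rw [← allOne_union]
        congr 1
        ext q
        rw [Finset.mem_union]
        grind
      have hval : (xorAt s (fun x => x r1 * x r2) ∘ (σ1 ∘ σ2)) x s = allOne C x := by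
        rw [comp_apply, xorAt_self, comp_apply, v1, hvr2, ← hCeq, hoff1 _ _ hs1',
          hoff2 _ _ hs2', hx s hs, zero_add]
      refine ⟨hval, fun h q hq => ?_⟩
      by_cases hqs : q = s
      · rw [hqs, hval, h]
      · rw [hCeq, fin_two_mul_eq_one_iff] at h
        rw [comp_apply, xorAt_of_ne hqs, comp_apply]
        by_cases hq1 : q ∈ S1
        · exact w1 h.1 q hq1
        · rw [hoff1 _ _ hq1]
          exact w2 h.2 q ((m4 q).2 ⟨⟨hqs, hq⟩, hq1⟩)

/-- Given qubits `S` in state one, the conjunction of `R` is reduced to that of few flags. The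
qubits read by one tree, whose flag vouches for them, serve as the clean qubits of the next. -/
theorem exists_flags (e b : ℕ) : ∀ S R : Finset ι, Disjoint S R → S.Nonempty → R.Nonempty →
    R.card + S.card ≤ S.card * 2 ^ b → R.card ≤ 2 ^ e →
    ∃ σ fl, fl ⊆ S ∪ R ∧ 2 * fl.card ≤ R.card + 1 ∧ fl.card ≤ b ∧
      Realizes (S ∪ R) (b * (19 * e + 1)) σ ∧
      ∀ x, (∀ q ∈ S, x q = 1) → allOne fl (σ x) = allOne R x := by
  induction b with
  | zero =>
    intro S R _ _ hR h
    have := hR.card_pos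
    omega
  | succ b ih =>
    intro S R hdisj hS hR hcard he
    have hS0 := hS.card_pos
    have hR0 := hR.card_pos
    have hSR : ∀ q, q ∈ S → q ∉ R := fun _ h => Finset.disjoint_left.1 hdisj h
    have hmul : (b + 1) * (19 * e + 1) = b * (19 * e + 1) + (19 * e + 1) := by ring
    -- Last stage: the supply suffices for one tree on all of `R`, and its root is the only new
    -- flag.
    by_cases hle : R.card ≤ S.card + 1
    · obtain ⟨S', hS', hc'⟩ := Finset.exists_subset_card_eq (s := S) (n := R.card - 1) (by omega)
      obtain ⟨σ, r, hr, hσ, hoff, hon⟩ := exists_and_tree e R S'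
        (hdisj.symm.mono_right hS') (by omega) he
      have hsub : R ∪ S' ⊆ S ∪ R := by
        rw [Finset.union_comm]; exact Finset.union_subset_union_left hS'
      refine ⟨σ ∘ flipAll S', {r}, Finset.singleton_subset_iff.2 (hsub hr), by
        rw [Finset.card_singleton]; omega, by rw [Finset.card_singleton]; omega,
        ((hσ.mono hsub le_rfl).comp ((Realizes.flipAll S').mono
          (hS'.trans Finset.subset_union_left) le_rfl)).mono subset_rfl (by omega), ?_⟩
      intro x hx
      rw [allOne_singleton, comp_apply, (hon (flipAll S' x) _).1]
      · exact allOne_congr fun q hq => if_neg fun h => hSR q (hS' h) hq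
      · intro q hq
        rw [flipAll, if_pos hq, hx q (hS' hq)]
        rfl
    · obtain ⟨C, hC, hcC⟩ := Finset.exists_subset_card_eq (s := R) (n := S.card + 1) (by omega)
      have hCS : Disjoint C S := hdisj.symm.mono_left hC
      obtain ⟨σ, r, hr, hσ, hoff, hon⟩ := exists_and_tree e C S hCS hcC (by omega)
      have hcR : (R \ C).card = R.card - (S.card + 1) := by
        rw [Finset.card_sdiff_of_subset hC, hcC]
      -- The next supply consists of all tree qubits but the flag, twice as many as before.
      have hcS : ((C ∪ S).erase r).card = 2 * S.card := by
        rw [Finset.card_erase_of_mem hr, Finset.card_union_of_disjoint hCS]; omega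
      have hsub : (C ∪ S).erase r ∪ R \ C ⊆ S ∪ R := by
        intro q
        simp only [Finset.mem_union, Finset.mem_erase, Finset.mem_sdiff]
        have := @hC q
        tauto
      have hsub' : C ∪ S ⊆ S ∪ R := by
        rw [Finset.union_comm]; exact Finset.union_subset_union_right hC
      have hp : S.card * 2 ^ (b + 1) = 2 * S.card * 2 ^ b := by ring
      obtain ⟨τ, fl, hfl, hfl2, hflb, hτ, hflag⟩ := ih ((C ∪ S).erase r) (R \ C) (by
          rw [Finset.disjoint_left]
          intro q hq hq'
          rw [Finset.mem_erase, Finset.mem_union] at hq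
          rw [Finset.mem_sdiff] at hq'
          have := hSR q
          tauto) (Finset.card_pos.1 (by omega)) (Finset.card_pos.1 (by omega))
        (by rw [hcR, hcS]; omega) (by omega)
      -- The flag is left out of all later stages, which therefore preserve it.
      have hrout : r ∉ (C ∪ S).erase r ∪ R \ C := by
        rw [Finset.mem_union] at hr
        simp only [Finset.mem_union, Finset.mem_erase, Finset.mem_sdiff]
        have := hSR r
        tauto
      have hrfl : r ∉ fl := fun h => hrout (hfl h)
      refine ⟨τ ∘ (σ ∘ flipAll S), insert r fl, ?_, ?_, ?_, ?_, ?_⟩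
      · exact Finset.insert_subset (hsub' hr) (hfl.trans hsub)
      · rw [Finset.card_insert_of_notMem hrfl]; omega
      · rw [Finset.card_insert_of_notMem hrfl]; omega
      · exact ((hτ.mono hsub le_rfl).comp ((hσ.mono hsub' le_rfl).comp
          ((Realizes.flipAll S).mono Finset.subset_union_left le_rfl))).mono subset_rfl
          (by omega)
      · intro x hx
        have hflip : ∀ q ∈ R, flipAll S x q = x q := fun q hq => if_neg fun h => hSR q h hq
        obtain ⟨hval, hones⟩ := hon (flipAll S x) fun q hq => by
          rw [flipAll, if_pos hq, hx q hq]
          rfl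
        have hCx : allOne C (flipAll S x) = allOne C x :=
          allOne_congr fun q hq => hflip q (hC hq)
        rw [hCx] at hval hones
        have hRx : allOne R x = allOne C x * allOne (R \ C) x := by
          rw [← allOne_union, Finset.union_sdiff_of_subset hC]
        rw [allOne_insert, comp_apply, comp_apply, hτ.apply_of_notMem hrout, hval, hRx]
        rw [fin_two_eq_iff, fin_two_mul_eq_one_iff, fin_two_mul_eq_one_iff]
        -- Only a flag equal to one matters: it certifies the supply of the next stage. Otherwise
        -- both conjunctions vanish.
        refine and_congr_right fun h1 => ?_
        rw [hflag]
        · rw [allOne_congr (y := x)]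
          intro q hq
          rw [Finset.mem_sdiff] at hq
          rw [hoff _ _ fun h => hSR q h hq.1, hflip q hq.1]
        · intro q hq
          rw [Finset.mem_erase, Finset.mem_union] at hq
          by_cases hqS : q ∈ S
          · exact hones h1 q hqS
          · have hqC := hq.2.resolve_right hqS
            rw [hoff _ _ hqS, hflip q (hC hqC)]
            exact allOne_eq_one_iff.1 h1 q hqC

/-! ### Assembly with one borrowed qubit -/

/-- The multi-controlled `X` gate in depth quadratic in the logarithm of the number of controls,
given one borrowed qubit `a`. -/
theorem Realizes.xorAt_allOne_log (S : Finset ι) (t a : ι)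
    (ht : t ∉ S) (ha : a ∉ S) (hta : t ≠ a) :
    Realizes Finset.univ (200 * (Nat.clog 2 S.card + 1) ^ 2) (xorAt t (allOne S)) := by
  have hcard : S.card + 2 ≤ Fintype.card ι := by
    have := Finset.card_le_univ (insert t (insert a S))
    rwa [Finset.card_insert_of_notMem (by simp [hta, ht]),
      Finset.card_insert_of_notMem ha] at this
  set b := Nat.clog 2 S.card with hb
  have hpow : S.card ≤ 2 ^ b := Nat.le_pow_clog (by norm_num) _
  by_cases hle : S.card ≤ 1
  · refine (Realizes.xorAt_allOne S t ht hcard).mono subset_rfl ?_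
    have h1 : S.card ^ 2 ≤ 1 ^ 2 := Nat.pow_le_pow_left hle 2
    have h2 : 1 ^ 2 ≤ (b + 1) ^ 2 := Nat.pow_le_pow_left (by omega) 2
    omega
  · obtain ⟨c, hc⟩ := Finset.card_pos.1 (by omega : 0 < S.card)
    have hR := Finset.card_erase_of_mem hc
    have hins : {c} ∪ S.erase c = S := by rw [← Finset.insert_eq, Finset.insert_erase hc]
    obtain ⟨σ, fl, hfl, hfl2, hflb, hσ, hflag⟩ := exists_flags b b {c} (S.erase c)
      (by simp) (Finset.singleton_nonempty c) (Finset.card_pos.1 (by omega))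
      (by rw [Finset.card_singleton]; omega) (by omega)
    rw [hins] at hfl hσ
    obtain ⟨τ, hτ, hτσ, -⟩ := hσ.exists_inverse
    have hafl : a ∉ fl := fun h => ha (hfl h)
    have htfl : t ∉ fl := fun h => ht (hfl h)
    -- At least two controls and at most half as many flags: some control is not a flag and can be
    -- the spare qubit.
    have hF := Realizes.xorAt_allOne (insert a fl) t (by simp [hta, htfl])
      (by rw [Finset.card_insert_of_notMem hafl]; omega)
    rw [Finset.card_insert_of_notMem hafl] at hF
    -- Computing the flags, using them and uncomputing leaves only the change of the target, on
    -- which neither `σ` nor `τ` depends.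
    have hG : τ ∘ (xorAt t (allOne (insert a fl)) ∘ σ) =
        xorAt t fun x => x a * allOne fl (σ x) := by
      ext1 x
      rw [comp_apply, comp_apply, xorAt, hτ.update_comm t ht, hτσ, allOne_insert,
        hσ.apply_of_notMem ht, hσ.apply_of_notMem ha, xorAt]
    have hGr := (hτ.mono (Finset.subset_univ _) le_rfl).comp
      (hF.comp (hσ.mono (Finset.subset_univ _) le_rfl))
    rw [hG] at hGr
    have hca : c ≠ a := fun h => ha (h ▸ hc)
    have hct : c ≠ t := fun h => ht (h ▸ hc)
    have hN := hGr.comp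
      (Realizes.cnot (A := Finset.univ) (Finset.mem_univ c) (Finset.mem_univ a) hca)
    have hU := hN.comp hN
    rw [xorAt_commutator hta (f := fun x => x c) (fun x v => update_of_ne hct _ _)
      (fun x v => update_of_ne hca _ _)
      (fun x v => by rw [hσ.update_comm t ht, allOne_update htfl])
      (fun x v => by rw [hσ.update_comm a ha, allOne_update hafl])] at hU
    have hfin : (fun x : ι → Fin 2 => x c * allOne fl (σ x)) = allOne S := by
      ext1 x
      rw [← Finset.insert_erase hc, allOne_insert, fin_two_eq_iff, fin_two_mul_eq_one_iff,
        fin_two_mul_eq_one_iff]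
      -- The flags are meaningful only if `c` is one, since `c` is the initial supply; for `c` zero
      -- both sides vanish.
      refine and_congr_right fun h => ?_
      rw [hflag x (by simpa using h)]
    rw [hfin] at hU
    refine hU.mono subset_rfl ?_
    have h1 : (fl.card + 1) ^ 2 ≤ (b + 1) ^ 2 := Nat.pow_le_pow_left (by omega) 2
    nlinarith

theorem exists_circuit_mcx_borrowed (n : ℕ) : ∃ C : QCircuit (Register n),
    ImplementsMCXBorrowed n C ∧ C.depth ≤ 200 * (Nat.clog 2 n + 1) ^ 2 := by
  have h := (Realizes.xorAt_allOne_log (Register.controls n) (Register.target n)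
    (Register.ancilla n) (by simp [Register.controls, Register.target])
    (by simp [Register.controls, Register.ancilla])
    (by simp [Register.target, Register.ancilla])).implements
  rw [← mcx_eq_permOp] at h
  obtain ⟨C, -, hC, hd⟩ := h
  refine ⟨C, hC, ?_⟩
  rw [Register.controls, Finset.card_map, Finset.card_univ, Fintype.card_fin] at hd
  exact hd

/-! ### Asymptotics of the depth -/

theorem Nat.clog_two_add_one_le (n : ℕ) (hn : 3 ≤ n) :
    (Nat.clog 2 n : ℝ) + 1 ≤ 4 * Real.log n := by
  have hn' : (3 : ℝ) ≤ n := by exact_mod_cast hn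
  have hlog : 1 ≤ Real.log n := by
    rw [Real.le_log_iff_exp_le (by linarith)]
    linarith [Real.exp_one_lt_d9]
  have h1 : (Nat.clog 2 n : ℝ) ≤ Nat.log 2 n + 1 := by
    exact_mod_cast Nat.clog_le_of_le_pow (Nat.lt_pow_succ_log_self (by norm_num) n).le
  have h2 : (Nat.log 2 n : ℝ) * Real.log 2 ≤ Real.log n := by
    rw [← Real.log_pow]
    apply Real.log_le_log (by positivity)
    exact_mod_cast Nat.pow_log_le_self 2 (by omega)
  have h3 := Real.log_two_gt_d9
  have h4 : (0 : ℝ) ≤ Nat.log 2 n := Nat.cast_nonneg _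
  nlinarith

theorem theorem1 :
    ∃ circ : (n : ℕ) → QCircuit (Register n),
      (∀ n : ℕ, ImplementsMCXBorrowed n (circ n)) ∧
      (fun n : ℕ => ((circ n).depth : ℝ)) =O[Filter.atTop]
        (fun n : ℕ => Real.log (n : ℝ) ^ (2.799 : ℝ)) := by
  choose circ himp hdepth using exists_circuit_mcx_borrowed
  refine ⟨circ, himp, Asymptotics.IsBigO.of_bound 3200 ?_⟩
  filter_upwards [Filter.eventually_ge_atTop 3] with n hn
  have hlog : 1 ≤ Real.log n := by
    rw [Real.le_log_iff_exp_le (by positivity)]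
    have hn' : (3 : ℝ) ≤ n := by exact_mod_cast hn
    linarith [Real.exp_one_lt_d9]
  have h1 : ((circ n).depth : ℝ) ≤ 200 * ((Nat.clog 2 n : ℝ) + 1) ^ 2 := by
    exact_mod_cast hdepth n
  have h2 := Nat.clog_two_add_one_le n hn
  -- The exponent 2 lies below 2.799, and enlarging it is harmless since the logarithm is at least
  -- one.
  have h3 : Real.log n ^ 2 ≤ Real.log n ^ (2.799 : ℝ) := by
    rw [← Real.rpow_natCast]
    exact Real.rpow_le_rpow_of_exponent_le hlog (by norm_num)
  rw [Real.norm_of_nonneg (Nat.cast_nonneg _), Real.norm_of_nonneg (by positivity)]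
  calc ((circ n).depth : ℝ) ≤ 200 * ((Nat.clog 2 n : ℝ) + 1) ^ 2 := h1
    _ ≤ 200 * (4 * Real.log n) ^ 2 := by gcongr
    _ = 3200 * Real.log n ^ 2 := by ring
    _ ≤ 3200 * Real.log n ^ (2.799 : ℝ) := by gcongr
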